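/- Partitions and compositions of $n$ have positive parts; a partition $\lambda$ is identified with its diagram $\{(i,j): 1\le i\le \ell(\lambda),\ 1\le j\le\lambda_i\}$, with row $1$ on top, and $P(n)$, $C(n)$ denote the sets of partitions and compositions of $n$. A (nonempty) rim-hook is a set of unit boxes that can be traversed by starting at some box and successively moving one step to the right or one step up; its size is its number of boxes, and its sign is $\operatorname{sgn}(\sigma)=(-1)^{r-1}$, where $r$ is the number of rows that it occupies. A partition $\gamma$ is obtained from $\lambda$ by removing a rim-hook if $\gamma\subseteq\lambda$ and $\lambda/\gamma=\lambda\setminus\gamma$ is a nonempty rim-hook. For $\lambda\in P(n)$ and $\beta=(\beta_1,\dots,\beta_s)\in C(n)$, a rim-hook tableau of shape $\lambda$ and content $\beta$ is a filling of the boxes of $\lambda$ with labels in $\{1,\dots,s\}$ such that, for every $k\in\{1,\dots,s\}$, the boxes with label $k$ form a rim-hook of size $\beta_k$ and the boxes with labels $1,\dots,k$ form the diagram of a partition. Its sign is the product of the signs of its $s$ rim-hooks. Let $A_n$ be the $P(n)\times C(n)$ rational matrix whose entry $A_n(\lambda,\beta)$ is the sum of the signs of all rim-hook tableaux of shape $\lambda$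 and content $\beta$. Let $Z_\beta=\beta_1(\beta_1+\beta_2)\cdots(\beta_1+\cdots+\beta_s)$, and let $B_n$ be the $C(n)\times P(n)$ matrix with entries $B_n(\beta,\mu)=A_n(\mu,\beta)/Z_\beta$. **Theorem.** (1) Let $n>0$ and $\lambda,\mu\in P(n)$, and let $G(\lambda,\mu)$ be the set of all partitions $\gamma$ that can be obtained from $\lambda$ by removing a nonempty rim-hook and can also be obtained from $\mu$ by removing a nonempty rim-hook. Then $$\sum_{\gamma\in G(\lambda,\mu)} n^{-1}\operatorname{sgn}(\lambda/\gamma)\operatorname{sgn}(\mu/\gamma)=\begin{cases}1&\text{if }\lambda=\mu,\\0&\text{if }\lambda\ne\mu.\end{cases}$$ (2) For every $n\ge 0$, $A_nB_n=I_{P(n)}$; that is, $B_n$ is a right inverse of $A_n$. -/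

import Mathlib

/-- The diagram of an integer partition: row `i` (counted from the top, starting with `0`) has as
many boxes as the `i`-th largest part. A box is a pair (row, column). -/
def Nat.Partition.diagram {n : ℕ} (lam : n.Partition) : YoungDiagram :=
  YoungDiagram.ofRowLens (lam.parts.sort (· ≥ ·)) (Multiset.pairwise_sort lam.parts (· ≥ ·)).sortedGE

namespace RimHook

/-- The box `d` is one step to the right of the box `c`, or one step above it. -/
def Step (c d : ℕ × ℕ) : Prop :=
  d = (c.1, c.2 + 1) ∨ c = (d.1 + 1, d.2)

/-- A (nonempty) rim-hook: a set of boxes that can be traversed by starting at some box and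
successively moving one step to the right or one step up. Its size is its number of boxes. -/
def IsRimHook (s : Finset (ℕ × ℕ)) : Prop :=
  ∃ l : List (ℕ × ℕ), l ≠ [] ∧ l.IsChain Step ∧ l.toFinset = s

/-- The sign `(-1)^(r-1)` of a rim-hook that occupies `r` rows. -/
def sgn (s : Finset (ℕ × ℕ)) : ℚ :=
  (-1) ^ ((s.image Prod.fst).card - 1)

/-- The set difference of the diagrams of `lam` and `gam`. -/
def skew {n m : ℕ} (lam : n.Partition) (gam : m.Partition) : Finset (ℕ × ℕ) :=
  lam.diagram.cells \ gam.diagram.cells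

/-- `gam` is obtained from `lam` by removing a nonempty rim-hook. -/
def IsRemoval {n m : ℕ} (lam : n.Partition) (gam : m.Partition) : Prop :=
  gam.diagram ≤ lam.diagram ∧ IsRimHook (skew lam gam)

open Classical in
/-- The set of the partitions `gam` (of some `m < n`) that can be obtained from `lam` by removing
a nonempty rim-hook, and also from `mu` by removing a nonempty rim-hook. -/
noncomputable def G {n : ℕ} (lam mu : n.Partition) : Finset ((m : Fin n) × (m : ℕ).Partition) :=
  Finset.univ.filter fun gam => IsRemoval lam gam.2 ∧ IsRemoval mu gam.2

/-- Fillings of the diagram of `lam` with labels in `Fin s` (the labels `1, …, s`, shifted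
by one). -/
abbrev Filling {n : ℕ} (lam : n.Partition) (s : ℕ) : Type :=
  {c : ℕ × ℕ // c ∈ lam.diagram.cells} → Fin s

/-- The set of boxes of a filling that contain the label `k`. -/
def labelled {n s : ℕ} {lam : n.Partition} (S : Filling lam s) (k : Fin s) : Finset (ℕ × ℕ) :=
  (Finset.univ.filter fun c => S c = k).image Subtype.val

/-- The set of boxes of a filling that contain a label that is at most `k`. -/
def labelledLE {n s : ℕ} {lam : n.Partition} (S : Filling lam s) (k : Fin s) : Finset (ℕ × ℕ) :=
  (Finset.univ.filter fun c => S c ≤ k).image Subtype.val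

/-- Rim-hook tableaux of shape `lam` and content `be`: for all `k`, the boxes with label `k` form
a rim-hook of size `be_k`, and the boxes with labels at most `k` form a partition diagram. -/
def IsRHT {n : ℕ} (lam : n.Partition) (be : Composition n) (S : Filling lam be.length) : Prop :=
  ∀ k : Fin be.length,
    IsRimHook (labelled S k) ∧ (labelled S k).card = be.blocksFun k ∧
      ∃ nu : YoungDiagram, nu.cells = labelledLE S k

open Classical in
/-- The finite set of the rim-hook tableaux of shape `lam` and content `be`. -/
noncomputable def RHT {n : ℕ} (lam : n.Partition) (be : Composition n) :
    Finset (Filling lam be.length) :=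
  Finset.univ.filter (IsRHT lam be)

/-- The sign of a tableau: the product of the signs of all its rim-hooks. -/
def tableauSgn {n s : ℕ} {lam : n.Partition} (S : Filling lam s) : ℚ :=
  ∏ k : Fin s, sgn (labelled S k)

/-- The matrix `A_n`: the sum of the signs of the rim-hook tableaux of shape `lam` and
content `be`. -/
noncomputable def A (n : ℕ) : Matrix n.Partition (Composition n) ℚ :=
  Matrix.of fun lam be => ∑ S ∈ RHT lam be, tableauSgn S

/-- `Z_be = be_1 (be_1 + be_2) ⋯ (be_1 + ⋯ + be_s)`, the product of the partial sums of `be`. -/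
def Z {n : ℕ} (be : Composition n) : ℕ :=
  ∏ k : Fin be.length, be.sizeUpTo (k + 1)

/-- The matrix `B_n`, with entries `A_n(mu, be) / Z_be`. -/
noncomputable def B (n : ℕ) : Matrix (Composition n) n.Partition ℚ :=
  Matrix.of fun be mu => A n mu be / (Z be : ℚ)

end RimHook

/-! Encode a diagram with at most `N` rows by its set of beta numbers, row length plus `N - 1 - i`
for row `i`. Removing a rim-hook from rows `p, …, q` means lowering one element of this set to a
free position. The elements passed on the way come from rows `p + 1, …, q`, so the sign of the hook
is `(-1)` to the number of elements passed (`HookRows.beta_eq`, `HookRows.crossing_eq`,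
`exists_hookRows_of_mem_moves`).

Part (1) becomes a statement about pairs of moves of two sets `X`, `Y` with equal element sums and a
common result. If `X = Y`, the two moves coincide, all signs square to 1, and the moves number
exactly `n` (`card_moves_add`). If `X ≠ Y`, a common result forces `X \ Y` and `Y \ X` to be pairs
with equal sums, one nested in the other. The outer pair's larger element can be lowered to either
inner element while the other inner element is lowered to the outer pair's smaller element. These
two choices have opposite signs and cancel (`sum_commonMoves_of_ne`).

Part (2) follows by induction on `n`: strip the last rim-hook from both tableaux. The last factor of
`Z` is `n`. For a fixed size `m` of what remains, the inner sum over compositions of `m` is 1 or 0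
according to whether the two remaining diagrams agree, and the surviving terms form the sum of part
(1). -/

/-! ### Lowering elements of finite sets of natural numbers -/

namespace BetaSet

open Finset

/-- The pairs `(x, a)` such that `x ∈ X` can be lowered to the free position `a < x`. -/
def moves (X : Finset ℕ) : Finset (ℕ × ℕ) :=
  (X ×ˢ range (X.sup id)).filter fun p => p.2 < p.1 ∧ p.2 ∉ X

theorem mem_moves {X : Finset ℕ} {p : ℕ × ℕ} :
    p ∈ moves X ↔ p.1 ∈ X ∧ p.2 < p.1 ∧ p.2 ∉ X := by
  simp only [moves, mem_filter, mem_product, mem_range]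
  constructor
  · tauto
  · rintro ⟨h1, h2, h3⟩
    exact ⟨⟨h1, h2.trans_le (Finset.le_sup (f := id) h1)⟩, h2, h3⟩

/-- The set obtained from `X` by replacing `p.1` with `p.2`. -/
def slide (X : Finset ℕ) (p : ℕ × ℕ) : Finset ℕ :=
  insert p.2 (X.erase p.1)

/-- The number of elements of `X` that are passed when `p.1` is lowered to `p.2`. -/
def crossing (X : Finset ℕ) (p : ℕ × ℕ) : ℕ :=
  (X.filter fun z => p.2 < z ∧ z < p.1).card

theorem mem_slide {X : Finset ℕ} {p : ℕ × ℕ} {z : ℕ} :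
    z ∈ slide X p ↔ z = p.2 ∨ (z ≠ p.1 ∧ z ∈ X) := by
  simp [slide]

/-- The result remembers the move: `p.1` is the only element lost and `p.2` the only one gained. -/
theorem slide_injOn (X : Finset ℕ) : Set.InjOn (slide X) (moves X) := by
  rintro ⟨x, a⟩ hp ⟨y, b⟩ hq h
  have hp := mem_moves.1 (mem_coe.1 hp)
  have hq := mem_moves.1 (mem_coe.1 hq)
  have key : ∀ z, z ∈ slide X (x, a) ↔ z ∈ slide X (y, b) := fun z => by rw [h]
  simp only [mem_slide] at key
  have h1 := key x
  have h2 := key a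
  simp only at hp hq
  grind

theorem sum_slide {X : Finset ℕ} {p : ℕ × ℕ} (hp : p ∈ moves X) :
    ∑ z ∈ slide X p, z + p.1 = ∑ z ∈ X, z + p.2 := by
  obtain ⟨h1, -, h3⟩ := mem_moves.1 hp
  rw [slide, sum_insert (by simp [h3]), ← sum_erase_add X (fun z => z) h1]
  ring

/-- Adjoining a new maximum `m` to `s` blocks no old move, since all old targets lie below `m`, and
creates one move for each of the `m - s.card` free positions below `m`. -/
theorem card_moves_add (X : Finset ℕ) :
    (moves X).card + ∑ i ∈ range X.card, i = ∑ x ∈ X, x := by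
  induction X using Finset.induction_on_max with
  | empty => simp [moves]
  | insert m s hm ih =>
    have hms : m ∉ s := fun h => lt_irrefl _ (hm m h)
    have hE : moves (insert m s) = moves s ∪ (range m \ s).image (fun j => (m, j)) := by
      ext ⟨x, a⟩
      simp only [mem_union, mem_moves, mem_image, mem_sdiff, mem_range, mem_insert, Prod.mk.injEq]
      constructor
      · rintro ⟨rfl | h1, h2, h3⟩
        · right; exact ⟨a, ⟨h2, by tauto⟩, rfl, rfl⟩
        · left; exact ⟨h1, h2, by tauto⟩
      · rintro (⟨h1, h2, h3⟩ | ⟨j, ⟨h1, h2⟩, rfl, rfl⟩)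
        · have := hm x h1
          refine ⟨Or.inr h1, h2, ?_⟩
          rintro (rfl | h)
          · omega
          · exact h3 h
        · refine ⟨Or.inl rfl, h1, ?_⟩
          rintro (rfl | h)
          · omega
          · exact h2 h
    have hd : Disjoint (moves s) ((range m \ s).image (fun j => (m, j))) := by
      rw [disjoint_left]
      rintro ⟨x, a⟩ h h'
      obtain ⟨j, -, hj⟩ := mem_image.1 h'
      obtain ⟨rfl, rfl⟩ := Prod.mk.inj hj
      exact hms (mem_moves.1 h).1
    have hs : s ⊆ range m := fun z hz => mem_range.2 (hm z hz)
    have hc := card_le_card hs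
    rw [card_range] at hc
    rw [hE, card_union_of_disjoint hd, card_image_of_injective _ (Prod.mk_right_injective m),
      card_sdiff_of_subset hs, card_range, card_insert_of_notMem hms, sum_range_succ,
      sum_insert hms, ← ih]
    omega

/-- On the left both moves pass the window strictly between `a` and `y`, where `X` and `Y` agree,
which gives the even term. The move of `y` also passes `a ∈ Y`, whereas the move of `x` meets
nothing at `y ∉ X`; this gives the odd 1. -/
theorem crossing_exchange {X Y : Finset ℕ} {x y a b : ℕ} (hba : b < a) (hay : a < y) (hyx : y < x)
    (hy : y ∉ X) (ha : a ∈ Y) (h : ∀ z, a < z → z < y → (z ∈ X ↔ z ∈ Y)) :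
    crossing X (x, a) + crossing Y (y, b) =
      crossing X (x, y) + crossing Y (a, b) + 2 * (X.filter fun z => a < z ∧ z < y).card + 1 := by
  have h1 : X.filter (fun z => a < z ∧ z < x) =
      X.filter (fun z => y < z ∧ z < x) ∪ X.filter (fun z => a < z ∧ z < y) := by
    ext z
    simp only [mem_union, mem_filter]
    constructor
    · rintro ⟨hz, h1, h2⟩
      rcases lt_trichotomy z y with h3 | rfl | h3
      · exact Or.inr ⟨hz, h1, h3⟩
      · exact absurd hz hy
      · exact Or.inl ⟨hz, h3, h2⟩
    · rintro (⟨hz, h1, h2⟩ | ⟨hz, h1, h2⟩)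
      · exact ⟨hz, by omega, h2⟩
      · exact ⟨hz, h1, by omega⟩
  have h2 : Y.filter (fun z => b < z ∧ z < y) =
      insert a (Y.filter (fun z => b < z ∧ z < a) ∪ X.filter (fun z => a < z ∧ z < y)) := by
    ext z
    simp only [mem_insert, mem_union, mem_filter]
    constructor
    · rintro ⟨hz, h1, h2⟩
      rcases lt_trichotomy z a with h3 | rfl | h3
      · exact Or.inr (Or.inl ⟨hz, h1, h3⟩)
      · exact Or.inl rfl
      · exact Or.inr (Or.inr ⟨(h z h3 h2).2 hz, h3, h2⟩)
    · rintro (rfl | ⟨hz, h1, h2⟩ | ⟨hz, h1, h2⟩)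
      · exact ⟨ha, hba, hay⟩
      · exact ⟨hz, h1, by omega⟩
      · exact ⟨(h z h1 h2).1 hz, by omega, h2⟩
  have d1 : Disjoint (X.filter (fun z => y < z ∧ z < x)) (X.filter (fun z => a < z ∧ z < y)) := by
    rw [disjoint_left]
    intro z hz hz'
    simp only [mem_filter] at hz hz'
    omega
  have d2 : Disjoint (Y.filter (fun z => b < z ∧ z < a)) (X.filter (fun z => a < z ∧ z < y)) := by
    rw [disjoint_left]
    intro z hz hz'
    simp only [mem_filter] at hz hz'
    omega
  simp only [crossing]
  rw [h1, h2, card_union_of_disjoint d1, card_insert_of_notMem, card_union_of_disjoint d2]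
  · ring
  · simp

/-- The hypotheses are symmetric in `a` and `y`, so `crossing_exchange` applies whichever of the two
is smaller. -/
theorem sign_exchange {X Y : Finset ℕ} {x y a b : ℕ} (hba : b < a) (hby : b < y) (hax : a < x)
    (hyx : y < x) (hay : a ≠ y) (hy : y ∉ X) (ha : a ∈ Y) (ha' : a ∉ X) (hy' : y ∈ Y)
    (h : ∀ z, z ≠ x → z ≠ y → z ≠ a → z ≠ b → (z ∈ X ↔ z ∈ Y)) :
    (-1 : ℚ) ^ crossing X (x, a) * (-1) ^ crossing Y (y, b) +
      (-1) ^ crossing X (x, y) * (-1) ^ crossing Y (a, b) = 0 := by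
  rw [← pow_add, ← pow_add]
  rcases hay.lt_or_gt with hay | hay
  · rw [crossing_exchange hba hay hyx hy ha
      fun z h1 h2 => h z (by omega) (by omega) (by omega) (by omega)]
    rw [pow_succ, pow_add _ _ (2 * _), pow_mul]
    simp
  · rw [crossing_exchange hby hay hax ha' hy'
      fun z h1 h2 => h z (by omega) (by omega) (by omega) (by omega)]
    rw [pow_succ, pow_add _ _ (2 * _), pow_mul]
    simp

/-- The pairs of moves of `X` and `Y` with the same result. -/
def commonMoves (X Y : Finset ℕ) : Finset ((ℕ × ℕ) × (ℕ × ℕ)) :=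
  (moves X ×ˢ moves Y).filter fun r => slide X r.1 = slide Y r.2

/-- In short, `X \ Y = {x, b}` and `Y \ X = {y, a}`, with equal sums. The targets differ: `a = b`
would force `x = y` by the sums, and then `X = Y`. -/
theorem commonMoves_facts {X Y : Finset ℕ} (hne : X ≠ Y) (hsum : ∑ z ∈ X, z = ∑ z ∈ Y, z)
    {x a y b : ℕ} (hr : ((x, a), (y, b)) ∈ commonMoves X Y) :
    x + b = y + a ∧ x ∈ X ∧ x ∉ Y ∧ y ∈ Y ∧ y ∉ X ∧ a ∈ Y ∧ a ∉ X ∧ b ∈ X ∧ b ∉ Y ∧ a < x ∧ b < y ∧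
      a ≠ b ∧ a ≠ y ∧ b ≠ x ∧ x ≠ y ∧ ∀ z, z ≠ x → z ≠ y → z ≠ a → z ≠ b → (z ∈ X ↔ z ∈ Y) := by
  simp only [commonMoves, mem_filter, mem_product] at hr
  obtain ⟨⟨hp, hq⟩, hs⟩ := hr
  have s1 := sum_slide hp
  have s2 := sum_slide hq
  rw [hs] at s1
  simp only at s1 s2
  have e : x + b = y + a := by omega
  have key : ∀ z, z ∈ slide X (x, a) ↔ z ∈ slide Y (y, b) := fun z => by rw [hs]
  simp only [mem_slide] at key
  obtain ⟨hx, hax, ha⟩ := mem_moves.1 hp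
  obtain ⟨hy, hby, hb⟩ := mem_moves.1 hq
  simp only at hx hax ha hy hby hb
  have hab : a ≠ b := by
    rintro rfl
    have : x = y := by omega
    subst this
    apply hne
    ext z
    have := key z
    grind
  have hxy : x ≠ y := by omega
  have kx := key x
  have ky := key y
  have ka := key a
  have kb := key b
  have hay : a ≠ y := by grind
  have hbx : b ≠ x := by grind
  refine ⟨e, hx, ?_, hy, ?_, ?_, ha, ?_, hb, hax, hby, hab, hay, hbx, hxy,
    fun z h1 h2 h3 h4 => ?_⟩
  · clear ky ka kb; grind
  · clear kx ka kb; grind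
  · clear ky kx kb; grind
  · clear ky ka kx; grind
  · have := key z
    clear kx ky ka kb key
    grind

theorem mem_commonMoves {X Y : Finset ℕ} {x a y b : ℕ} : ((x, a), (y, b)) ∈ commonMoves X Y ↔
    ((x ∈ X ∧ a < x ∧ a ∉ X) ∧ (y ∈ Y ∧ b < y ∧ b ∉ Y)) ∧
      ∀ z, (z = a ∨ z ≠ x ∧ z ∈ X) ↔ (z = b ∨ z ≠ y ∧ z ∈ Y) := by
  simp only [commonMoves, mem_filter, mem_product, mem_moves, Finset.ext_iff, mem_slide]

/-- The sign-reversing involution on the common moves of two different sets. -/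
def exchange (r : (ℕ × ℕ) × (ℕ × ℕ)) : (ℕ × ℕ) × (ℕ × ℕ) :=
  if r.2.1 < r.1.1 then ((r.1.1, r.2.1), (r.1.2, r.2.2)) else ((r.2.2, r.1.2), (r.2.1, r.1.1))

/-- If `y < x`, then `x` is the largest and `b` the smallest of the four exceptional numbers, and
`exchange` swaps the intermediate `a` and `y`. Otherwise `y` is the largest and `a` the smallest,
and it swaps `x` and `b`; this is the same situation with `X` and `Y` interchanged. -/
theorem sum_commonMoves_of_ne {X Y : Finset ℕ} (hne : X ≠ Y) (hsum : ∑ z ∈ X, z = ∑ z ∈ Y, z) :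
    ∑ r ∈ commonMoves X Y, (-1 : ℚ) ^ crossing X r.1 * (-1) ^ crossing Y r.2 = 0 := by
  apply Finset.sum_involution (fun r _ => exchange r)
  · rintro ⟨⟨x, a⟩, ⟨y, b⟩⟩ hr
    obtain ⟨e, hxX, hxY, hyY, hyX, haY, haX, hbX, hbY, hax, hby, hab, hay, hbx, hxy, h⟩ :=
      commonMoves_facts hne hsum hr
    simp only [exchange]
    split_ifs with hlt
    · exact sign_exchange (by omega) hby hax hlt hay hyX haY haX hyY h
    · have := sign_exchange (X := Y) (Y := X) (x := y) (y := x) (a := b) (b := a) (by omega) hax hby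
        (by omega) hbx hxY hbX hbY hxX fun z h1 h2 h3 h4 => (h z h2 h1 h4 h3).symm
      linarith
  · rintro ⟨⟨x, a⟩, ⟨y, b⟩⟩ hr -
    obtain ⟨e, hxX, hxY, hyY, hyX, haY, haX, hbX, hbY, hax, hby, hab, hay, hbx, hxy, h⟩ :=
      commonMoves_facts hne hsum hr
    simp only [exchange]
    split_ifs with hlt
    · simp only [ne_eq, Prod.mk.injEq, not_and]; omega
    · simp only [ne_eq, Prod.mk.injEq, not_and]; omega
  · rintro ⟨⟨x, a⟩, ⟨y, b⟩⟩ hr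
    obtain ⟨e, hxX, hxY, hyY, hyX, haY, haX, hbX, hbY, hax, hby, hab, hay, hbx, hxy, h⟩ :=
      commonMoves_facts hne hsum hr
    simp only [exchange]
    split_ifs with hlt
    · rw [mem_commonMoves]
      refine ⟨⟨⟨hxX, hlt, hyX⟩, ⟨haY, by omega, hbY⟩⟩, fun z => ?_⟩
      have := h z
      grind
    · rw [mem_commonMoves]
      refine ⟨⟨⟨hbX, by omega, haX⟩, ⟨hyY, by omega, hxY⟩⟩, fun z => ?_⟩
      have := h z
      grind
  · rintro ⟨⟨x, a⟩, ⟨y, b⟩⟩ hr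
    obtain ⟨e, hxX, hxY, hyY, hyX, haY, haX, hbX, hbY, hax, hby, hab, hay, hbx, hxy, h⟩ :=
      commonMoves_facts hne hsum hr
    by_cases hlt : y < x
    · simp [exchange, hlt, hax]
    · have : ¬ y < b := by omega
      simp [exchange, hlt, this]

theorem sum_commonMoves_self (X : Finset ℕ) :
    ∑ r ∈ commonMoves X X, (-1 : ℚ) ^ crossing X r.1 * (-1) ^ crossing X r.2 = (moves X).card := by
  have : commonMoves X X = (moves X).image fun p => (p, p) := by
    ext ⟨p, q⟩
    simp only [commonMoves, mem_filter, mem_product, mem_image, Prod.mk.injEq]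
    constructor
    · rintro ⟨⟨hp, hq⟩, h⟩
      exact ⟨p, hp, rfl, slide_injOn X hp hq h⟩
    · rintro ⟨r, hr, rfl, rfl⟩
      exact ⟨⟨hr, hr⟩, rfl⟩
  rw [this, sum_image fun p _ q _ h => (Prod.mk.inj h).1]
  simp [← pow_add, ← two_mul]

end BetaSet

/-! ### Young diagrams through their row lengths -/

namespace YoungDiagram

theorem le_iff_rowLen_le {lam mu : YoungDiagram} : lam ≤ mu ↔ ∀ i, lam.rowLen i ≤ mu.rowLen i := by
  constructor
  · intro h i
    by_contra! hlt
    exact lt_irrefl _ (mem_iff_lt_rowLen.1 (h (mem_iff_lt_rowLen.2 hlt)))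
  · rintro h ⟨i, j⟩ hc
    exact mem_iff_lt_rowLen.2 ((mem_iff_lt_rowLen.1 hc).trans_le (h i))

theorem ext_rowLen {lam mu : YoungDiagram} (h : ∀ i, lam.rowLen i = mu.rowLen i) : lam = mu :=
  le_antisymm (le_iff_rowLen_le.2 fun i => (h i).le) (le_iff_rowLen_le.2 fun i => (h i).ge)

theorem mem_cells_sdiff {lam mu : YoungDiagram} {i j : ℕ} :
    (i, j) ∈ lam.cells \ mu.cells ↔ mu.rowLen i ≤ j ∧ j < lam.rowLen i := by
  rw [Finset.mem_sdiff, mem_cells, mem_cells, mem_iff_lt_rowLen, mem_iff_lt_rowLen, not_lt,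
    and_comm]

theorem exists_rowLen_eq {lam : YoungDiagram} {g : ℕ → ℕ} (hg : Antitone g)
    (hle : ∀ i, g i ≤ lam.rowLen i) : ∃ mu : YoungDiagram, ∀ i, mu.rowLen i = g i := by
  have hL : IsLowerSet (lam.cells.filter (fun c => c.2 < g c.1) : Set (ℕ × ℕ)) := by
    rintro ⟨i, j⟩ ⟨i', j'⟩ ⟨h1, h2⟩ hc
    simp only [Finset.coe_filter, Set.mem_ofPred_eq] at hc ⊢
    exact ⟨lam.up_left_mem h1 h2 hc.1, (h2.trans_lt hc.2).trans_le (hg h1)⟩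
  refine ⟨⟨_, hL⟩, fun i => ?_⟩
  apply eq_of_forall_lt_iff
  intro j
  rw [← mem_iff_lt_rowLen, mem_mk, Finset.mem_filter, mem_cells, mem_iff_lt_rowLen]
  exact ⟨fun h => h.2, fun h => ⟨h.trans_le (hle i), h⟩⟩

end YoungDiagram

/-! ### Rim-hooks described row by row -/

namespace RimHook

open YoungDiagram

/-- The skew shape `lam / gam` occupies the rows `p, …, q`, and consecutive rows among them overlap
in exactly one column. -/
structure HookRows (lam gam : YoungDiagram) (p q : ℕ) : Prop where
  le : p ≤ q
  above : ∀ i < p, gam.rowLen i = lam.rowLen i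
  below : ∀ i, q < i → gam.rowLen i = lam.rowLen i
  overlap : ∀ i, p ≤ i → i < q → gam.rowLen i + 1 = lam.rowLen (i + 1)
  bottom : gam.rowLen q < lam.rowLen q

theorem HookRows.lt {lam gam : YoungDiagram} {p q : ℕ} (h : HookRows lam gam p q) {i : ℕ}
    (hp : p ≤ i) (hq : i ≤ q) : gam.rowLen i < lam.rowLen i := by
  rcases hq.eq_or_lt with rfl | hq
  · exact h.bottom
  · have := h.overlap i hp hq
    have := lam.rowLen_anti i (i + 1) (by omega)
    omega

theorem HookRows.subset {lam gam : YoungDiagram} {p q : ℕ} (h : HookRows lam gam p q) :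
    gam ≤ lam := by
  rw [le_iff_rowLen_le]
  intro i
  by_cases h1 : i < p
  · exact (h.above i h1).le
  by_cases h2 : q < i
  · exact (h.below i h2).le
  exact (h.lt (by omega) (by omega)).le

theorem HookRows.mem_iff {lam gam : YoungDiagram} {p q : ℕ} (h : HookRows lam gam p q) {i j : ℕ} :
    (i, j) ∈ lam.cells \ gam.cells ↔ p ≤ i ∧ i ≤ q ∧ gam.rowLen i ≤ j ∧ j < lam.rowLen i := by
  rw [mem_cells_sdiff]
  constructor
  · intro hc
    refine ⟨?_, ?_, hc⟩
    · by_contra hlt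
      have := h.above i (by omega)
      omega
    · by_contra hlt
      have := h.below i (by omega)
      omega
  · exact fun hc => hc.2.2

theorem HookRows.sgn_eq {lam gam : YoungDiagram} {p q : ℕ} (h : HookRows lam gam p q) :
    sgn (lam.cells \ gam.cells) = (-1) ^ (q - p) := by
  have : (lam.cells \ gam.cells).image Prod.fst = Finset.Icc p q := by
    ext i
    simp only [Finset.mem_image, Prod.exists, exists_and_right, exists_eq_right, Finset.mem_Icc]
    constructor
    · rintro ⟨j, hj⟩
      rw [h.mem_iff] at hj
      exact ⟨hj.1, hj.2.1⟩
    · rintro ⟨h1, h2⟩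
      exact ⟨gam.rowLen i, h.mem_iff.2 ⟨h1, h2, le_rfl, h.lt h1 h2⟩⟩
  rw [sgn, this, Nat.card_Icc]
  congr 1
  omega

/-- The set `s` can be traversed by a rim-hook path that ends in the box `e`. -/
def EndsAt (s : Finset (ℕ × ℕ)) (e : ℕ × ℕ) : Prop :=
  ∃ l : List (ℕ × ℕ), (l ++ [e]).IsChain Step ∧ (l ++ [e]).toFinset = s

theorem EndsAt.singleton (e : ℕ × ℕ) : EndsAt {e} e := ⟨[], by simp, by simp⟩

theorem EndsAt.isRimHook {s : Finset (ℕ × ℕ)} {e : ℕ × ℕ} (h : EndsAt s e) : IsRimHook s := by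
  obtain ⟨l, h1, h2⟩ := h
  exact ⟨l ++ [e], by simp, h1, h2⟩

theorem EndsAt.insert {s : Finset (ℕ × ℕ)} {e f : ℕ × ℕ} (h : EndsAt s e) (hs : Step e f) :
    EndsAt (insert f s) f := by
  obtain ⟨l, h1, h2⟩ := h
  refine ⟨l ++ [e], ?_, ?_⟩
  · rw [List.isChain_append]
    refine ⟨h1, by simp, ?_⟩
    simpa using hs
  · rw [List.toFinset_append, h2]
    ext c
    simp

theorem HookRows.endsAt_row {lam gam : YoungDiagram} {p q i : ℕ} (h : HookRows lam gam p q)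
    (hp : p ≤ i) (hq : i ≤ q)
    (hs : EndsAt ((lam.cells \ gam.cells).filter
      fun c => i < c.1 ∨ c.1 = i ∧ c.2 ≤ gam.rowLen i) (i, gam.rowLen i)) (t : ℕ) :
    gam.rowLen i + t < lam.rowLen i →
      EndsAt ((lam.cells \ gam.cells).filter
        fun c => i < c.1 ∨ c.1 = i ∧ c.2 ≤ gam.rowLen i + t) (i, gam.rowLen i + t) := by
  induction t with
  | zero => exact fun _ => hs
  | succ t ih =>
    intro ht
    convert (ih (by omega)).insert (f := (i, gam.rowLen i + (t + 1))) (Or.inl rfl) using 1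
    ext ⟨i', j'⟩
    rw [Finset.mem_insert, Finset.mem_filter, Finset.mem_filter, h.mem_iff, Prod.mk.injEq]
    constructor
    · rintro ⟨h0, h5 | ⟨rfl, h6⟩⟩
      · exact Or.inr ⟨h0, Or.inl h5⟩
      · rcases Nat.lt_or_ge (gam.rowLen i' + t) j' with h7 | h7
        · left; dsimp only at *; omega
        · exact Or.inr ⟨h0, Or.inr ⟨rfl, h7⟩⟩
    · rintro (⟨rfl, rfl⟩ | ⟨h0, h5 | ⟨rfl, h6⟩⟩)
      · exact ⟨⟨hp, by omega, by omega, ht⟩, Or.inr ⟨rfl, le_rfl⟩⟩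
      · exact ⟨h0, Or.inl h5⟩
      · exact ⟨h0, Or.inr ⟨rfl, by dsimp only at *; omega⟩⟩

theorem HookRows.endsAt {lam gam : YoungDiagram} {p q : ℕ} (h : HookRows lam gam p q) (d : ℕ) :
    ∀ i, p ≤ i → i + d = q → ∀ t, gam.rowLen i + t < lam.rowLen i →
      EndsAt ((lam.cells \ gam.cells).filter
        fun c => i < c.1 ∨ c.1 = i ∧ c.2 ≤ gam.rowLen i + t) (i, gam.rowLen i + t) := by
  induction d with
  | zero =>
    intro i hp hq
    refine h.endsAt_row hp (by omega) ?_
    convert EndsAt.singleton (i, gam.rowLen i) using 1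
    ext ⟨i', j'⟩
    rw [Finset.mem_filter, h.mem_iff, Finset.mem_singleton, Prod.mk.injEq]
    constructor
    · rintro ⟨⟨h1, h2, h3, h4⟩, h5 | ⟨rfl, h6⟩⟩ <;> dsimp only at * <;> omega
    · rintro ⟨rfl, rfl⟩
      exact ⟨⟨hp, by omega, le_rfl, h.lt hp (by omega)⟩, Or.inr ⟨rfl, le_rfl⟩⟩
  | succ d ih =>
    intro i hp hq
    have hov := h.overlap i hp (by omega)
    have hlt := h.lt (i := i + 1) (by omega) (by omega)
    -- This offset leads to column `gam.rowLen i`, the last box of row `i + 1` by the overlap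
    -- condition; from there one step up enters row `i` at its first box.
    have ih' := ih (i + 1) (by omega) (by omega) (gam.rowLen i - gam.rowLen (i + 1)) (by omega)
    have hanti := gam.rowLen_anti i (i + 1) (by omega)
    rw [Nat.add_sub_cancel' hanti] at ih'
    refine h.endsAt_row hp (by omega) ?_
    convert ih'.insert (f := (i, gam.rowLen i)) (Or.inr rfl) using 1
    ext ⟨i', j'⟩
    rw [Finset.mem_insert, Finset.mem_filter, Finset.mem_filter, h.mem_iff, Prod.mk.injEq]
    constructor
    · rintro ⟨⟨h1, h2, h3, h4⟩, h5 | ⟨rfl, h6⟩⟩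
      · right
        refine ⟨⟨h1, h2, h3, h4⟩, ?_⟩
        dsimp only at *
        rcases (Nat.succ_le_of_lt h5).eq_or_lt with rfl | h6
        · right; exact ⟨rfl, by rw [Nat.succ_eq_add_one] at h4; omega⟩
        · left; omega
      · left; dsimp only at *; omega
    · rintro (⟨rfl, rfl⟩ | ⟨h0, h5⟩)
      · exact ⟨⟨hp, by omega, by omega, h.lt hp (by omega)⟩, Or.inr ⟨rfl, le_rfl⟩⟩
      · exact ⟨h0, Or.inl (by dsimp only at *; omega)⟩

theorem HookRows.isRimHook {lam gam : YoungDiagram} {p q : ℕ} (h : HookRows lam gam p q) :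
    IsRimHook (lam.cells \ gam.cells) := by
  have hlt := h.lt le_rfl h.le
  have := h.endsAt (q - p) p le_rfl (by have := h.le; omega)
    (lam.rowLen p - 1 - gam.rowLen p) (by omega)
  convert this.isRimHook using 1
  ext ⟨i, j⟩
  rw [Finset.mem_filter, h.mem_iff]
  constructor
  · rintro ⟨h1, h2, h3, h4⟩
    refine ⟨⟨h1, h2, h3, h4⟩, ?_⟩
    dsimp only
    rcases h1.eq_or_lt with rfl | h1
    · right; omega
    · left; exact h1
  · exact fun h => h.1

/-- Along the path rows weakly decrease and columns weakly increase, so the last box lies in the top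
row `p` and the first box in the bottom row `q`. -/
theorem IsRimHook.exists_hookRows {lam gam : YoungDiagram} (hle : gam ≤ lam)
    (h : IsRimHook (lam.cells \ gam.cells)) : ∃ p q, HookRows lam gam p q := by
  obtain ⟨l, hne, hc, hs⟩ := h
  have hlen : 0 < l.length := List.length_pos_iff.2 hne
  have hpw : l.Pairwise fun c d => d.1 ≤ c.1 ∧ c.2 ≤ d.2 := by
    have : IsTrans (ℕ × ℕ) (fun c d => d.1 ≤ c.1 ∧ c.2 ≤ d.2) :=
      ⟨fun a b c h1 h2 => ⟨h2.1.trans h1.1, h1.2.trans h2.2⟩⟩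
    refine List.IsChain.pairwise (hc.imp ?_)
    rintro ⟨i, j⟩ ⟨i', j'⟩ hs
    simp only [Step, Prod.mk.injEq] at hs
    dsimp only
    omega
  have hmono : ∀ a b (ha : a < l.length) (hb : b < l.length), a ≤ b →
      l[b].1 ≤ l[a].1 ∧ l[a].2 ≤ l[b].2 := by
    intro a b ha hb hab
    rcases hab.eq_or_lt with rfl | hab
    · exact ⟨le_rfl, le_rfl⟩
    · exact List.pairwise_iff_getElem.1 hpw a b ha hb hab
  have hmem : ∀ i j, (gam.rowLen i ≤ j ∧ j < lam.rowLen i) ↔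
      ∃ k, ∃ hk : k < l.length, l[k] = (i, j) := by
    intro i j
    rw [← mem_cells_sdiff, ← hs, List.mem_toFinset, List.mem_iff_getElem]
  have hmem' : ∀ k (hk : k < l.length), gam.rowLen l[k].1 ≤ l[k].2 ∧ l[k].2 < lam.rowLen l[k].1 :=
    fun k hk => (hmem _ _).2 ⟨k, hk, rfl⟩
  have hrow : ∀ i, gam.rowLen i ≤ lam.rowLen i := le_iff_rowLen_le.1 hle
  have hout : ∀ i, (∀ k (hk : k < l.length), l[k].1 ≠ i) → gam.rowLen i = lam.rowLen i := by
    intro i hi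
    by_contra hn
    obtain ⟨k, hk, e⟩ := (hmem i (gam.rowLen i)).1 ⟨le_rfl, lt_of_le_of_ne (hrow i) hn⟩
    exact hi k hk (by rw [e])
  refine ⟨l[l.length - 1].1, l[0].1, (hmono 0 (l.length - 1) hlen (by omega) (by omega)).1,
    fun i hi => hout i fun k hk e => ?_, fun i hi => hout i fun k hk e => ?_, fun i hp hq => ?_, ?_⟩
  · have := (hmono k (l.length - 1) hk (by omega) (by omega)).1
    omega
  · have := (hmono 0 k hlen hk (by omega)).1
    omega
  -- The first box in a row at most `i` must be entered by an upward step from row `i + 1` in the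
  -- same column `c`.
  · have hex : ∃ k, ∃ hk : k < l.length, l[k].1 ≤ i := ⟨l.length - 1, by omega, hp⟩
    classical
    obtain ⟨hk, hki⟩ := Nat.find_spec hex
    have hmin : ∀ m < Nat.find hex, ∀ hm : m < l.length, i < l[m].1 := by
      intro m hm hm'
      have := Nat.find_min hex hm
      by_contra hle'
      exact this ⟨hm', by omega⟩
    generalize Nat.find hex = k at hk hki hmin
    obtain ⟨m, rfl⟩ : ∃ m, k = m + 1 := by
      refine Nat.exists_eq_succ_of_ne_zero ?_
      rintro rfl
      omega
    have hup := hmin m (by omega) (by omega)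
    have hstep := List.isChain_iff_getElem.1 hc m hk
    obtain ⟨c, hc1, hc2⟩ : ∃ c, l[m] = (i + 1, c) ∧ l[m + 1] = (i, c) := by
      rcases hstep with h' | h'
      · rw [h'] at hki
        dsimp only at hki
        omega
      · refine ⟨l[m + 1].2, ?_, ?_⟩
        · rw [h'] at hup ⊢
          dsimp only at hup
          rw [Prod.mk.injEq]
          exact ⟨by omega, rfl⟩
        · rw [h'] at hup
          dsimp only at hup
          rw [Prod.ext_iff]
          exact ⟨by dsimp only; omega, rfl⟩
    have b1 := hmem' m (by omega)
    have b2 := hmem' (m + 1) hk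
    rw [hc1] at b1
    rw [hc2] at b2
    dsimp only at b1 b2
    -- A box of row `i` left of `c`, or of row `i + 1` right of `c`, would violate monotonicity of
    -- the path before or after this step. So `c` is the only column shared by the two rows.
    have g : gam.rowLen i = c := by
      by_contra hn
      obtain ⟨t, ht, e⟩ := (hmem i (c - 1)).1 ⟨by omega, by omega⟩
      rcases Nat.lt_or_ge t (m + 1) with h' | h'
      · have := hmin t h' ht
        rw [e] at this
        exact lt_irrefl _ this
      · have := (hmono _ _ hk ht h').2
        rw [e, hc2] at this
        dsimp only at this
        omega
    have g' : lam.rowLen (i + 1) = c + 1 := by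
      by_contra hn
      obtain ⟨t, ht, e⟩ := (hmem (i + 1) (c + 1)).1 ⟨by omega, by omega⟩
      rcases Nat.lt_or_ge t (m + 1) with h' | h'
      · have := (hmono t m ht (by omega) (by omega)).2
        rw [e, hc1] at this
        dsimp only at this
        omega
      · have := (hmono _ _ hk ht h').1
        rw [e, hc2] at this
        dsimp only at this
        omega
    omega
  · have := hmem' 0 hlen
    omega

end RimHook

/-! ### Beta numbers: rim-hook removals as moves -/

namespace RimHook

open YoungDiagram BetaSet

/-- The beta number of row `i` of a diagram with at most `N` rows. -/
def betaNum (N : ℕ) (lam : YoungDiagram) (i : ℕ) : ℕ := lam.rowLen i + (N - 1 - i)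

/-- The set of the beta numbers of a diagram with at most `N` rows. -/
def beta (N : ℕ) (lam : YoungDiagram) : Finset ℕ := (Finset.range N).image (betaNum N lam)

theorem mem_beta {N : ℕ} {lam : YoungDiagram} {z : ℕ} :
    z ∈ beta N lam ↔ ∃ i < N, betaNum N lam i = z := by
  simp [beta]

theorem betaNum_lt {N : ℕ} (lam : YoungDiagram) {i j : ℕ} (hij : i < j) (hj : j < N) :
    betaNum N lam j < betaNum N lam i := by
  have := lam.rowLen_anti i j hij.le
  unfold betaNum
  omega

theorem betaNum_lt_iff {N : ℕ} (lam : YoungDiagram) {i j : ℕ} (hi : i < N) (hj : j < N) :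
    betaNum N lam j < betaNum N lam i ↔ i < j := by
  constructor
  · intro h
    by_contra! hle
    rcases hle.eq_or_lt with rfl | hlt
    · exact lt_irrefl _ h
    · exact lt_asymm h (betaNum_lt lam hlt hi)
  · exact fun h => betaNum_lt lam h hj

theorem betaNum_injOn (N : ℕ) (lam : YoungDiagram) :
    Set.InjOn (betaNum N lam) (Finset.range N) := by
  intro i hi j hj h
  have hi := Finset.mem_range.1 (Finset.mem_coe.1 hi)
  have hj := Finset.mem_range.1 (Finset.mem_coe.1 hj)
  have h1 := betaNum_lt_iff lam hi hj
  have h2 := betaNum_lt_iff lam hj hi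
  omega

theorem card_beta (N : ℕ) (lam : YoungDiagram) : (beta N lam).card = N := by
  rw [beta, Finset.card_image_of_injOn (betaNum_injOn N lam), Finset.card_range]

theorem rowLen_eq_zero {lam : YoungDiagram} {N i : ℕ} (h : lam.rowLen N = 0) (hi : N ≤ i) :
    lam.rowLen i = 0 := by
  have := lam.rowLen_anti N i hi
  omega

/-- Beta numbers strictly decrease with the row; read backwards they form a strictly increasing
sequence, which its range determines. -/
theorem beta_injective {N : ℕ} {lam mu : YoungDiagram} (hl : lam.rowLen N = 0)
    (hm : mu.rowLen N = 0) (h : beta N lam = beta N mu) : lam = mu := by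
  have hmono : ∀ nu : YoungDiagram, StrictMono fun i : Fin N => betaNum N nu (Fin.rev i) := by
    intro nu i j hij
    exact betaNum_lt nu (Fin.rev_lt_rev.2 hij) (Fin.rev i).2
  have hrange : ∀ nu : YoungDiagram,
      Set.range (fun i : Fin N => betaNum N nu (Fin.rev i)) = (beta N nu : Set ℕ) := by
    intro nu
    ext z
    rw [Finset.mem_coe, mem_beta, Set.mem_range]
    constructor
    · rintro ⟨i, rfl⟩
      exact ⟨_, (Fin.rev i).2, rfl⟩
    · rintro ⟨i, hi, rfl⟩
      exact ⟨Fin.rev ⟨i, hi⟩, by rw [Fin.rev_rev]⟩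
  have key := ((hmono lam).range_inj (hmono mu)).1 (by rw [hrange, hrange, h])
  apply ext_rowLen
  intro i
  rcases Nat.lt_or_ge i N with hi | hi
  · have := congrFun key (Fin.rev ⟨i, hi⟩)
    simp only [Fin.rev_rev, betaNum] at this
    omega
  · rw [rowLen_eq_zero hl hi, rowLen_eq_zero hm hi]

theorem card_eq_sum_rowLen {N : ℕ} {lam : YoungDiagram} (h : lam.rowLen N = 0) :
    lam.card = ∑ i ∈ Finset.range N, lam.rowLen i := by
  rw [YoungDiagram.card, Finset.card_eq_sum_card_fiberwise (f := Prod.fst) (t := Finset.range N)]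
  · exact Finset.sum_congr rfl fun i _ => (lam.rowLen_eq_card).symm
  · rintro ⟨i, j⟩ hc
    rw [Finset.mem_coe, mem_cells, mem_iff_lt_rowLen] at hc
    rw [Finset.mem_coe, Finset.mem_range]
    by_contra! hi
    rw [rowLen_eq_zero h hi] at hc
    omega

theorem sum_beta {N : ℕ} {lam : YoungDiagram} (h : lam.rowLen N = 0) :
    ∑ z ∈ beta N lam, z = lam.card + ∑ i ∈ Finset.range N, i := by
  rw [beta, Finset.sum_image (betaNum_injOn N lam), card_eq_sum_rowLen h,
    ← Finset.sum_range_reflect (fun i => i), ← Finset.sum_add_distrib]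
  rfl

theorem card_moves_beta {N : ℕ} {lam : YoungDiagram} (h : lam.rowLen N = 0) :
    (moves (beta N lam)).card = lam.card := by
  have := card_moves_add (beta N lam)
  rw [card_beta, sum_beta h] at this
  omega

theorem HookRows.lt_of_rowLen {lam gam : YoungDiagram} {p q N : ℕ} (h : HookRows lam gam p q)
    (hN : lam.rowLen N = 0) : q < N := by
  by_contra! hq
  have := rowLen_eq_zero hN hq
  have := h.bottom
  omega

/-- Moving up one row raises `N - 1 - i` by one, which compensates exactly for the single column of
overlap. -/
theorem HookRows.betaNum_overlap {lam gam : YoungDiagram} {p q N : ℕ} (h : HookRows lam gam p q)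
    (hN : q < N) {i : ℕ} (hp : p ≤ i) (hq : i < q) :
    betaNum N gam i = betaNum N lam (i + 1) := by
  have := h.overlap i hp hq
  unfold betaNum
  omega

theorem HookRows.mem_moves {lam gam : YoungDiagram} {p q N : ℕ} (h : HookRows lam gam p q)
    (hN : q < N) : (betaNum N lam p, betaNum N gam q) ∈ moves (beta N lam) := by
  have hb : betaNum N gam q < betaNum N lam q := by
    have := h.bottom
    unfold betaNum
    omega
  have hle : ∀ i ≤ q, betaNum N lam q ≤ betaNum N lam i := fun i hi => by
    rcases hi.eq_or_lt with rfl | hi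
    · exact le_rfl
    · exact (betaNum_lt lam hi hN).le
  rw [BetaSet.mem_moves]
  refine ⟨mem_beta.2 ⟨p, h.le.trans_lt hN, rfl⟩, hb.trans_le (hle p h.le), ?_⟩
  rw [mem_beta]
  rintro ⟨i, hi, e⟩
  dsimp only at e
  rcases Nat.lt_or_ge q i with hq | hq
  · have h1 := betaNum_lt gam hq hi
    have h2 := h.below i hq
    unfold betaNum at *
    omega
  · have := hle i hq
    omega

/-- Rows `p, …, q - 1` of `gam` inherit the numbers of rows `p + 1, …, q` of `lam`. Only the number
of row `p` of `lam` is lost, and only that of row `q` of `gam` is new. -/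
theorem HookRows.beta_eq {lam gam : YoungDiagram} {p q N : ℕ} (h : HookRows lam gam p q)
    (hN : q < N) : beta N gam = slide (beta N lam) (betaNum N lam p, betaNum N gam q) := by
  have hp := h.le
  ext z
  rw [mem_slide, mem_beta, mem_beta]
  dsimp only
  constructor
  · rintro ⟨i, hi, rfl⟩
    by_cases h1 : i < p
    · right
      have e : betaNum N gam i = betaNum N lam i := by rw [betaNum, h.above i h1, betaNum]
      exact ⟨by rw [e]; exact (betaNum_lt lam h1 (by omega)).ne', i, hi, e.symm⟩
    by_cases h2 : q < i
    · right
      have e : betaNum N gam i = betaNum N lam i := by rw [betaNum, h.below i h2, betaNum]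
      exact ⟨by rw [e]; exact (betaNum_lt lam (by omega) hi).ne, i, hi, e.symm⟩
    rcases Nat.lt_or_ge i q with h3 | h3
    · right
      have e := h.betaNum_overlap hN (not_lt.1 h1) h3
      exact ⟨by rw [e]; exact (betaNum_lt lam (by omega) (by omega)).ne, i + 1, by omega, e.symm⟩
    · left
      rw [show i = q by omega]
  · rintro (rfl | ⟨hne, i, hi, rfl⟩)
    · exact ⟨q, hN, rfl⟩
    by_cases h1 : i < p
    · exact ⟨i, hi, by rw [betaNum, h.above i h1, betaNum]⟩
    by_cases h2 : q < i
    · exact ⟨i, hi, by rw [betaNum, h.below i h2, betaNum]⟩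
    have h3 : i ≠ p := by
      rintro rfl
      exact hne rfl
    refine ⟨i - 1, by omega, ?_⟩
    rw [h.betaNum_overlap hN (by omega) (by omega), Nat.sub_add_cancel (by omega)]

theorem HookRows.crossing_eq {lam gam : YoungDiagram} {p q N : ℕ} (h : HookRows lam gam p q)
    (hN : q < N) : crossing (beta N lam) (betaNum N lam p, betaNum N gam q) = q - p := by
  have hp := h.le
  have hE : (beta N lam).filter (fun z => betaNum N gam q < z ∧ z < betaNum N lam p) =
      (Finset.Ioc p q).image (betaNum N lam) := by
    ext z
    rw [Finset.mem_filter, mem_beta, Finset.mem_image]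
    constructor
    · rintro ⟨⟨i, hi, rfl⟩, h1, h2⟩
      refine ⟨i, Finset.mem_Ioc.2 ⟨(betaNum_lt_iff lam (by omega) hi).1 h2, ?_⟩, rfl⟩
      by_contra! hq
      have h3 := betaNum_lt gam hq hi
      have h4 := h.below i hq
      unfold betaNum at *
      omega
    · rintro ⟨i, hi, rfl⟩
      rw [Finset.mem_Ioc] at hi
      refine ⟨⟨i, by omega, rfl⟩, ?_, betaNum_lt lam hi.1 (by omega)⟩
      have h1 : betaNum N lam q ≤ betaNum N lam i := by
        rcases hi.2.eq_or_lt with rfl | h2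
        · exact le_rfl
        · exact (betaNum_lt lam h2 hN).le
      have h2 := h.bottom
      unfold betaNum at *
      omega
  rw [crossing, hE, Finset.card_image_of_injOn, Nat.card_Ioc]
  refine (betaNum_injOn N lam).mono fun i hi => ?_
  have := Finset.mem_Ioc.1 (Finset.mem_coe.1 hi)
  simp only [Finset.coe_range, Set.mem_Iio]
  omega

theorem exists_hookRows_of_mem_moves {lam : YoungDiagram} {N : ℕ} (hN : lam.rowLen N = 0)
    {r : ℕ × ℕ} (hr : r ∈ moves (beta N lam)) :
    ∃ gam p q, HookRows lam gam p q ∧ q < N ∧ r = (betaNum N lam p, betaNum N gam q) := by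
  obtain ⟨x, a⟩ := r
  obtain ⟨hx, hax, ha⟩ := BetaSet.mem_moves.1 hr
  dsimp only at hx hax ha
  obtain ⟨p, hp, rfl⟩ := mem_beta.1 hx
  have ha' : ∀ i < N, betaNum N lam i ≠ a := fun i hi e => ha (mem_beta.2 ⟨i, hi, e⟩)
  -- The bottom row `q` of the hook is the last row whose beta number exceeds the target `a`.
  obtain ⟨q, hpq, hq, hqa, hgt⟩ : ∃ q, p ≤ q ∧ q < N ∧ a < betaNum N lam q ∧
      ∀ i, q < i → i < N → betaNum N lam i < a := by
    refine ⟨Nat.findGreatest (fun i => a < betaNum N lam i) (N - 1),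
      Nat.le_findGreatest (by omega) hax, ?_, Nat.findGreatest_spec (P := fun i => a < betaNum N lam i)
        (show p ≤ N - 1 by omega) hax, fun i h1 h2 => ?_⟩
    · have := Nat.findGreatest_le (P := fun i => a < betaNum N lam i) (N - 1)
      omega
    · have := Nat.findGreatest_is_greatest h1 (by omega)
      exact lt_of_le_of_ne (not_lt.1 this) (ha' i h2)
  -- This keeps the subtraction `a - (N - 1 - q)` below from truncating, and makes the new row `q`
  -- at least as long as row `q + 1`.
  have hlow : N - 1 - q ≤ a ∧ lam.rowLen (q + 1) + (N - 1 - q) ≤ a := by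
    rcases Nat.lt_or_ge (q + 1) N with h1 | h1
    · have := hgt (q + 1) (by omega) h1
      unfold betaNum at this
      omega
    · have := rowLen_eq_zero hN h1
      omega
  have hpos : 0 < lam.rowLen q := by
    unfold betaNum at hqa
    omega
  have hqa' : a - (N - 1 - q) < lam.rowLen q := by
    unfold betaNum at hqa
    omega
  obtain ⟨gam, hgam⟩ := exists_rowLen_eq (lam := lam)
    (g := fun i => if i < p then lam.rowLen i else if i < q then lam.rowLen (i + 1) - 1
      else if i = q then a - (N - 1 - q) else lam.rowLen i) (by
        apply antitone_nat_of_succ_le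
        intro i
        have h1 := lam.rowLen_anti i (i + 1) (by omega)
        have h2 := lam.rowLen_anti (i + 1) (i + 1 + 1) (by omega)
        by_cases hi : i + 1 = q
        · subst hi
          split_ifs <;> omega
        · by_cases hi' : i = q
          · subst hi'
            split_ifs <;> omega
          · split_ifs <;> omega)
    (by
      intro i
      have h1 := lam.rowLen_anti i (i + 1) (by omega)
      by_cases hi' : i = q
      · subst hi'
        split_ifs <;> omega
      · split_ifs <;> omega)
  have hgq : gam.rowLen q = a - (N - 1 - q) := by
    rw [hgam, if_neg (by omega), if_neg (by omega), if_pos rfl]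
  refine ⟨gam, p, q, ⟨hpq, fun i hi => by rw [hgam, if_pos hi],
    fun i hi => by rw [hgam, if_neg (by omega), if_neg (by omega), if_neg (by omega)],
    fun i h1 h2 => ?_, by omega⟩, hq, ?_⟩
  · rw [hgam, if_neg (by omega), if_pos h2]
    have := lam.rowLen_anti (i + 1) q (by omega)
    omega
  · rw [Prod.mk.injEq]
    refine ⟨rfl, ?_⟩
    rw [betaNum, hgq]
    omega

/-- The set of the diagrams that are obtained from `lam` by removing a rim-hook. -/
def removalSet (lam : YoungDiagram) : Set YoungDiagram :=
  {gam | gam ≤ lam ∧ IsRimHook (lam.cells \ gam.cells)}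

theorem finite_removalSet (lam : YoungDiagram) : (removalSet lam).Finite := by
  refine Set.Finite.of_finite_image (f := YoungDiagram.cells) (lam.cells.powerset.finite_toSet.subset ?_) ?_
  · rintro _ ⟨gam, h, rfl⟩
    exact Finset.mem_coe.2 (Finset.mem_powerset.2 (cells_subset_iff.2 h.1))
  · intro a _ b _ h
    exact YoungDiagram.ext h

/-- The finite set of the diagrams that are obtained from `lam` by removing a rim-hook. -/
noncomputable def removals (lam : YoungDiagram) : Finset YoungDiagram :=
  (finite_removalSet lam).toFinset

theorem mem_removals {lam gam : YoungDiagram} :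
    gam ∈ removals lam ↔ gam ≤ lam ∧ IsRimHook (lam.cells \ gam.cells) :=
  (finite_removalSet lam).mem_toFinset

theorem mem_removals_iff_hookRows {lam gam : YoungDiagram} :
    gam ∈ removals lam ↔ ∃ p q, HookRows lam gam p q := by
  rw [mem_removals]
  exact ⟨fun h => h.2.exists_hookRows h.1, fun ⟨p, q, h⟩ => ⟨h.subset, h.isRimHook⟩⟩

theorem exists_move_of_mem_removals {lam gam : YoungDiagram} {N : ℕ} (hN : lam.rowLen N = 0)
    (h : gam ∈ removals lam) : ∃ r ∈ moves (beta N lam), beta N gam = slide (beta N lam) r ∧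
      sgn (lam.cells \ gam.cells) = (-1) ^ crossing (beta N lam) r := by
  obtain ⟨p, q, h⟩ := mem_removals_iff_hookRows.1 h
  have hq := h.lt_of_rowLen hN
  exact ⟨_, h.mem_moves hq, h.beta_eq hq, by rw [h.crossing_eq hq, h.sgn_eq]⟩

theorem exists_removal_of_mem_moves {lam : YoungDiagram} {N : ℕ} (hN : lam.rowLen N = 0)
    {r : ℕ × ℕ} (hr : r ∈ moves (beta N lam)) :
    ∃ gam ∈ removals lam, beta N gam = slide (beta N lam) r := by
  obtain ⟨gam, p, q, h, hq, rfl⟩ := exists_hookRows_of_mem_moves hN hr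
  exact ⟨gam, mem_removals_iff_hookRows.2 ⟨p, q, h⟩, h.beta_eq hq⟩

theorem rowLen_eq_zero_of_mem_removals {lam gam : YoungDiagram} {N : ℕ} (hN : lam.rowLen N = 0)
    (h : gam ∈ removals lam) : gam.rowLen N = 0 := by
  have := le_iff_rowLen_le.1 (mem_removals.1 h).1 N
  omega

open Classical in
-- A common `gam` corresponds to the pair of moves with common result `beta N gam`; the result
-- determines both `gam` and the two moves.
theorem sum_removals_eq_sum_commonMoves {lam mu : YoungDiagram} {N : ℕ} (hl : lam.rowLen N = 0)
    (hm : mu.rowLen N = 0) :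
    ∑ gam ∈ removals lam ∩ removals mu,
        sgn (lam.cells \ gam.cells) * sgn (mu.cells \ gam.cells) =
      ∑ r ∈ commonMoves (beta N lam) (beta N mu),
        (-1) ^ crossing (beta N lam) r.1 * (-1) ^ crossing (beta N mu) r.2 := by
  choose! f hf1 hf2 hf3 using fun gam (h : gam ∈ removals lam) => exists_move_of_mem_removals hl h
  choose! g hg1 hg2 hg3 using fun gam (h : gam ∈ removals mu) => exists_move_of_mem_removals hm h
  refine Finset.sum_bij (fun gam _ => (f gam, g gam)) ?_ ?_ ?_ ?_
  · intro gam h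
    rw [Finset.mem_inter] at h
    rw [commonMoves, Finset.mem_filter, Finset.mem_product]
    exact ⟨⟨hf1 _ h.1, hg1 _ h.2⟩, by rw [← hf2 _ h.1, ← hg2 _ h.2]⟩
  · intro gam h gam' h' e
    rw [Finset.mem_inter] at h h'
    refine beta_injective (N := N) (rowLen_eq_zero_of_mem_removals hl h.1)
      (rowLen_eq_zero_of_mem_removals hl h'.1) ?_
    rw [hf2 _ h.1, hf2 _ h'.1, (Prod.mk.inj e).1]
  · rintro ⟨p, q⟩ hr
    rw [commonMoves, Finset.mem_filter, Finset.mem_product] at hr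
    obtain ⟨⟨hp, hq⟩, e⟩ := hr
    obtain ⟨gam, h1, h2⟩ := exists_removal_of_mem_moves hl hp
    obtain ⟨gam', h1', h2'⟩ := exists_removal_of_mem_moves hm hq
    obtain rfl : gam = gam' := beta_injective (N := N) (rowLen_eq_zero_of_mem_removals hl h1)
      (rowLen_eq_zero_of_mem_removals hm h1') (by rw [h2, h2', e])
    refine ⟨gam, Finset.mem_inter.2 ⟨h1, h1'⟩, ?_⟩
    rw [Prod.mk.injEq]
    exact ⟨slide_injOn _ (hf1 _ h1) hp (by rw [← hf2 _ h1, h2]),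
      slide_injOn _ (hg1 _ h1') hq (by rw [← hg2 _ h1', h2'])⟩
  · intro gam h
    rw [Finset.mem_inter] at h
    rw [hf3 _ h.1, hg3 _ h.2]

theorem exists_rowLen_eq_zero (lam mu : YoungDiagram) : ∃ N, lam.rowLen N = 0 ∧ mu.rowLen N = 0 := by
  have key : ∀ nu : YoungDiagram, ∃ N, ∀ i ≥ N, nu.rowLen i = 0 := fun nu =>
    ⟨nu.colLen 0, fun i hi => by
      by_contra h
      have := mem_iff_lt_colLen.1 (mem_iff_lt_rowLen.2 (Nat.pos_of_ne_zero h))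
      omega⟩
  obtain ⟨N, hN⟩ := key lam
  obtain ⟨M, hM⟩ := key mu
  exact ⟨max N M, hN _ (le_max_left _ _), hM _ (le_max_right _ _)⟩

open Classical in
/-- Orthogonality of the rim-hook removals of two diagrams of the same size. -/
theorem sum_removals {lam mu : YoungDiagram} (hcard : lam.card = mu.card) :
    ∑ gam ∈ removals lam ∩ removals mu,
        sgn (lam.cells \ gam.cells) * sgn (mu.cells \ gam.cells) =
      if lam = mu then (lam.card : ℚ) else 0 := by
  obtain ⟨N, hl, hm⟩ := exists_rowLen_eq_zero lam mu
  rw [sum_removals_eq_sum_commonMoves hl hm]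
  split_ifs with h
  · subst h
    rw [sum_commonMoves_self, card_moves_beta hl]
  · exact sum_commonMoves_of_ne (fun e => h (beta_injective hl hm e))
      (by rw [sum_beta hl, sum_beta hm, hcard])

end RimHook

/-! ### Partitions of `n` as Young diagrams with `n` boxes -/

namespace Nat.Partition

open YoungDiagram

theorem rowLens_diagram {n : ℕ} (lam : n.Partition) :
    lam.diagram.rowLens = lam.parts.sort (· ≥ ·) :=
  rowLens_ofRowLens_eq_self fun _ hx => lam.parts_pos ((Multiset.mem_sort _).1 hx)

theorem diagram_injective (n : ℕ) : Function.Injective (diagram (n := n)) := by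
  intro lam mu h
  have := congrArg (fun nu : YoungDiagram => (nu.rowLens : Multiset ℕ)) h
  simp only [rowLens_diagram, Multiset.sort_eq] at this
  exact Nat.Partition.ext this

theorem _root_.YoungDiagram.sum_rowLens (nu : YoungDiagram) : nu.rowLens.sum = nu.card := by
  have h : nu.rowLen (nu.colLen 0) = 0 := by
    by_contra h
    exact lt_irrefl _ (mem_iff_lt_colLen.1 (mem_iff_lt_rowLen.2 (Nat.pos_of_ne_zero h)))
  rw [RimHook.card_eq_sum_rowLen h, rowLens, ← List.sum_toFinset _ List.nodup_range,
    List.toFinset_range]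

theorem card_diagram {n : ℕ} (lam : n.Partition) : lam.diagram.card = n := by
  rw [← sum_rowLens, rowLens_diagram, ← Multiset.sum_coe, Multiset.sort_eq, lam.parts_sum]

theorem exists_diagram_eq {n : ℕ} {nu : YoungDiagram} (h : nu.card = n) :
    ∃ lam : n.Partition, lam.diagram = nu := by
  refine ⟨⟨nu.rowLens, fun {i} hi => nu.pos_of_mem_rowLens i (Multiset.mem_coe.1 hi), ?_⟩, ?_⟩
  · rw [Multiset.sum_coe, sum_rowLens, h]
  · apply equivListRowLens.injective
    apply Subtype.ext
    simp only [equivListRowLens_apply_coe, rowLens_diagram]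
    refine List.Perm.eq_of_pairwise' (r := (· ≥ ·)) (Multiset.pairwise_sort _ _) nu.rowLens_sorted.pairwise ?_
    rw [← Multiset.coe_eq_coe, Multiset.sort_eq]

end Nat.Partition

/-! ### Orthogonality for partitions -/

namespace RimHook

open YoungDiagram

theorem card_sdiff_cells {lam gam : YoungDiagram} (h : gam ≤ lam) :
    (lam.cells \ gam.cells).card + gam.card = lam.card :=
  Finset.card_sdiff_add_card_eq_card (cells_subset_iff.2 h)

theorem IsRimHook.card_pos {s : Finset (ℕ × ℕ)} (h : IsRimHook s) : 0 < s.card := by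
  obtain ⟨l, hne, -, rfl⟩ := h
  rw [Finset.card_pos, List.toFinset_nonempty_iff]
  exact hne

theorem card_lt_of_mem_removals {lam gam : YoungDiagram} (h : gam ∈ removals lam) :
    gam.card < lam.card := by
  obtain ⟨h1, h2⟩ := mem_removals.1 h
  have := card_sdiff_cells h1
  have := h2.card_pos
  omega

theorem mem_G {n : ℕ} {lam mu : n.Partition} {gam : (m : Fin n) × (m : ℕ).Partition} :
    gam ∈ G lam mu ↔
      gam.2.diagram ∈ removals lam.diagram ∧ gam.2.diagram ∈ removals mu.diagram := by
  classical
  rw [G, Finset.mem_filter, mem_removals, mem_removals]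
  exact and_iff_right (Finset.mem_univ _)

open Classical in
-- The diagram determines the size `m` and the partition, and `m < n` is automatic because a
-- rim-hook is nonempty.
theorem sum_G {n : ℕ} (lam mu : n.Partition) (f : YoungDiagram → ℚ) :
    ∑ gam ∈ G lam mu, f gam.2.diagram =
      ∑ gam ∈ removals lam.diagram ∩ removals mu.diagram, f gam := by
  refine Finset.sum_bij (fun gam _ => gam.2.diagram) ?_ ?_ ?_ fun _ _ => rfl
  · intro gam h
    exact Finset.mem_inter.2 (mem_G.1 h)
  · rintro ⟨m, gam⟩ - ⟨m', gam'⟩ - e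
    dsimp only at e
    obtain rfl : m = m' := Fin.ext (by rw [← gam.card_diagram, e, gam'.card_diagram])
    rw [Nat.Partition.diagram_injective _ e]
  · intro gam h
    rw [Finset.mem_inter] at h
    have hlt := card_lt_of_mem_removals h.1
    rw [lam.card_diagram] at hlt
    obtain ⟨m, hm⟩ : ∃ m, gam.card = m := ⟨_, rfl⟩
    obtain ⟨nu, rfl⟩ := Nat.Partition.exists_diagram_eq hm
    exact ⟨⟨⟨m, hm ▸ hlt⟩, nu⟩, mem_G.2 h, rfl⟩

theorem sum_G_sgn {n : ℕ} (hn : 0 < n) (lam mu : n.Partition) :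
    ∑ gam ∈ G lam mu, (n : ℚ)⁻¹ * sgn (skew lam gam.2) * sgn (skew mu gam.2) =
      if lam = mu then 1 else 0 := by
  classical
  have h := sum_G lam mu fun gam => (n : ℚ)⁻¹ *
    (sgn (lam.diagram.cells \ gam.cells) * sgn (mu.diagram.cells \ gam.cells))
  have hn' : (n : ℚ) ≠ 0 := by exact_mod_cast hn.ne'
  simp only [skew, mul_assoc]
  rw [h, ← Finset.mul_sum, sum_removals (by rw [lam.card_diagram, mu.card_diagram]),
    lam.card_diagram]
  simp only [(Nat.Partition.diagram_injective n).eq_iff]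
  split_ifs
  · exact inv_mul_cancel₀ hn'
  · exact mul_zero _

/-! ### Tableaux: splitting off the last rim-hook -/

/-- The boxes of a filling of a Young diagram that contain the label `k`. -/
def fiber {lam : YoungDiagram} {s : ℕ} (S : {c // c ∈ lam.cells} → Fin s) (k : Fin s) :
    Finset (ℕ × ℕ) :=
  (Finset.univ.filter fun c => S c = k).image Subtype.val

/-- The boxes of a filling of a Young diagram that contain a label that is at most `k`. -/
def fiberLE {lam : YoungDiagram} {s : ℕ} (S : {c // c ∈ lam.cells} → Fin s) (k : Fin s) :
    Finset (ℕ × ℕ) :=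
  (Finset.univ.filter fun c => S c ≤ k).image Subtype.val

/-- Rim-hook tableaux of shape `lam` and content `f`. -/
def IsTableau {lam : YoungDiagram} {s : ℕ} (f : Fin s → ℕ) (S : {c // c ∈ lam.cells} → Fin s) :
    Prop :=
  ∀ k, IsRimHook (fiber S k) ∧ (fiber S k).card = f k ∧
    ∃ nu : YoungDiagram, nu.cells = fiberLE S k

open Classical in
/-- The sum of the signs of the rim-hook tableaux of shape `lam` and content `f`. -/
noncomputable def tableauSum (lam : YoungDiagram) {s : ℕ} (f : Fin s → ℕ) : ℚ :=
  ∑ S : {c // c ∈ lam.cells} → Fin s with IsTableau f S, ∏ k, sgn (fiber S k)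

theorem mem_fiber {lam : YoungDiagram} {s : ℕ} {S : {c // c ∈ lam.cells} → Fin s} {k : Fin s}
    {c : ℕ × ℕ} : c ∈ fiber S k ↔ ∃ h : c ∈ lam.cells, S ⟨c, h⟩ = k := by
  simp [fiber]

theorem mem_fiberLE {lam : YoungDiagram} {s : ℕ} {S : {c // c ∈ lam.cells} → Fin s} {k : Fin s}
    {c : ℕ × ℕ} : c ∈ fiberLE S k ↔ ∃ h : c ∈ lam.cells, S ⟨c, h⟩ ≤ k := by
  simp [fiberLE]

/-- The filling of `lam` that extends a filling of `gam` by a new largest label. -/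
def extend (lam : YoungDiagram) {gam : YoungDiagram} {s : ℕ} (T : {c // c ∈ gam.cells} → Fin s) :
    {c // c ∈ lam.cells} → Fin (s + 1) :=
  fun c => if h : c.1 ∈ gam.cells then (T ⟨c.1, h⟩).castSucc else Fin.last s

theorem fiber_extend_castSucc {lam gam : YoungDiagram} (hle : gam ≤ lam) {s : ℕ}
    (T : {c // c ∈ gam.cells} → Fin s) (k : Fin s) :
    fiber (extend lam T) k.castSucc = fiber T k := by
  ext c
  rw [mem_fiber, mem_fiber]
  constructor
  · rintro ⟨h, e⟩
    by_cases hc : c ∈ gam.cells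
    · refine ⟨hc, ?_⟩
      simpa [extend, hc] using e
    · simp only [extend, hc, dite_false] at e
      exact absurd e.symm (Fin.castSucc_lt_last k).ne
  · rintro ⟨h, e⟩
    refine ⟨cells_subset_iff.2 hle h, ?_⟩
    simp [extend, h, e]

theorem fiber_extend_last {lam gam : YoungDiagram} {s : ℕ} (T : {c // c ∈ gam.cells} → Fin s) :
    fiber (extend lam T) (Fin.last s) = lam.cells \ gam.cells := by
  ext c
  rw [mem_fiber, Finset.mem_sdiff]
  constructor
  · rintro ⟨h, e⟩
    refine ⟨h, fun hc => ?_⟩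
    simp only [extend, hc, dite_true] at e
    exact (Fin.castSucc_lt_last _).ne e
  · rintro ⟨h, hc⟩
    exact ⟨h, by simp [extend, hc]⟩

theorem fiberLE_extend_castSucc {lam gam : YoungDiagram} (hle : gam ≤ lam) {s : ℕ}
    (T : {c // c ∈ gam.cells} → Fin s) (k : Fin s) :
    fiberLE (extend lam T) k.castSucc = fiberLE T k := by
  ext c
  rw [mem_fiberLE, mem_fiberLE]
  constructor
  · rintro ⟨h, e⟩
    by_cases hc : c ∈ gam.cells
    · refine ⟨hc, ?_⟩
      simpa [extend, hc] using e
    · simp only [extend, hc, dite_false] at e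
      exact absurd e (Fin.castSucc_lt_last k).not_ge
  · rintro ⟨h, e⟩
    refine ⟨cells_subset_iff.2 hle h, ?_⟩
    simp [extend, h, e]

theorem fiberLE_last {lam : YoungDiagram} {s : ℕ} (S : {c // c ∈ lam.cells} → Fin (s + 1)) :
    fiberLE S (Fin.last s) = lam.cells := by
  ext c
  rw [mem_fiberLE]
  exact ⟨fun h => h.1, fun h => ⟨h, Fin.le_last _⟩⟩

/-- The conditions for old labels do not see the new boxes. For the last label the diagram condition
is vacuous, since all boxes together form `lam`. -/
theorem isTableau_extend_iff {lam gam : YoungDiagram} (hle : gam ≤ lam) {s : ℕ}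
    (f : Fin (s + 1) → ℕ) (T : {c // c ∈ gam.cells} → Fin s) :
    IsTableau f (extend lam T) ↔ IsTableau (fun k => f k.castSucc) T ∧
      IsRimHook (lam.cells \ gam.cells) ∧ (lam.cells \ gam.cells).card = f (Fin.last s) := by
  rw [IsTableau, Fin.forall_fin_succ', IsTableau]
  simp only [fiber_extend_castSucc hle, fiberLE_extend_castSucc hle, fiber_extend_last,
    fiberLE_last]
  exact and_congr_right fun _ => ⟨fun h => ⟨h.1, h.2.1⟩, fun h => ⟨h.1, h.2, lam, rfl⟩⟩

theorem IsTableau.exists_extend {lam : YoungDiagram} {s : ℕ} {f : Fin (s + 1) → ℕ}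
    {S : {c // c ∈ lam.cells} → Fin (s + 1)} (hS : IsTableau f S) :
    ∃ gam : YoungDiagram, gam ≤ lam ∧ ∃ T : {c // c ∈ gam.cells} → Fin s, extend lam T = S := by
  obtain ⟨gam, hgam⟩ : ∃ gam : YoungDiagram,
      ∀ c, c ∈ gam.cells ↔ ∃ h : c ∈ lam.cells, S ⟨c, h⟩ ≠ Fin.last s := by
    -- The boxes without the last label form a diagram by the tableau condition for the preceding
    -- label; if there is no preceding label, they form the empty diagram.
    rcases s with _ | s
    · refine ⟨⊥, fun c => ?_⟩
      simp only [cells_bot, Finset.notMem_empty, false_iff, not_exists, not_not]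
      exact fun h => Fin.ext (by have := (S ⟨c, h⟩).2; simp only [Fin.val_last]; omega)
    · obtain ⟨nu, hnu⟩ := (hS (Fin.last s).castSucc).2.2
      refine ⟨nu, fun c => ?_⟩
      rw [hnu, mem_fiberLE]
      refine exists_congr fun h => ?_
      rw [Fin.le_castSucc_iff, Fin.succ_last, Fin.lt_last_iff_ne_last]
  refine ⟨gam, cells_subset_iff.1 fun c hc => ((hgam c).1 hc).1,
    fun c => (S ⟨c.1, ((hgam c.1).1 c.2).1⟩).castPred ((hgam c.1).1 c.2).2, ?_⟩
  funext ⟨c, hc⟩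
  by_cases h : c ∈ gam.cells
  · simp [extend, h]
  · have : S ⟨c, hc⟩ = Fin.last s := by
      by_contra hn
      exact h ((hgam c).2 ⟨hc, hn⟩)
    simp [extend, h, this]

theorem extend_injective {lam gam : YoungDiagram} (hle : gam ≤ lam) {s : ℕ} :
    Function.Injective (extend lam : ({c // c ∈ gam.cells} → Fin s) → _) := by
  intro T T' h
  funext ⟨c, hc⟩
  have := congrFun h ⟨c, cells_subset_iff.2 hle hc⟩
  simpa [extend, hc] using this

/-- The sum over all tableaux, sorted by the shape that remains without the last rim-hook. -/
theorem tableauSum_succ (lam : YoungDiagram) {s : ℕ} (f : Fin (s + 1) → ℕ) :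
    tableauSum lam f = ∑ gam ∈ removals lam with (lam.cells \ gam.cells).card = f (Fin.last s),
      sgn (lam.cells \ gam.cells) * tableauSum gam (fun k => f k.castSucc) := by
  classical
  simp only [tableauSum, Finset.mul_sum]
  rw [Finset.sum_sigma']
  symm
  refine Finset.sum_bij (fun r _ => extend lam r.2) ?_ ?_ ?_ ?_
  · rintro ⟨gam, T⟩ h
    simp only [Finset.mem_sigma, Finset.mem_filter, Finset.mem_univ, true_and, mem_removals] at h
    rw [Finset.mem_filter]
    exact ⟨Finset.mem_univ _, (isTableau_extend_iff h.1.1.1 f T).2 ⟨h.2, h.1.1.2, h.1.2⟩⟩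
  · rintro ⟨gam, T⟩ h ⟨gam', T'⟩ h' e
    simp only [Finset.mem_sigma, Finset.mem_filter, Finset.mem_univ, true_and, mem_removals] at h h'
    dsimp only at e
    -- The fiber of the last label recovers the removed hook, hence the smaller diagram.
    have hd : lam.cells \ gam.cells = lam.cells \ gam'.cells := by
      rw [← fiber_extend_last T, e, fiber_extend_last]
    have hg : gam = gam' := by
      apply YoungDiagram.ext
      rw [← Finset.sdiff_sdiff_eq_self (cells_subset_iff.2 h.1.1.1), hd,
        Finset.sdiff_sdiff_eq_self (cells_subset_iff.2 h'.1.1.1)]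
    subst hg
    rw [extend_injective h.1.1.1 e]
  · intro S hS
    rw [Finset.mem_filter] at hS
    obtain ⟨gam, hle, T, rfl⟩ := hS.2.exists_extend
    have := (isTableau_extend_iff hle f T).1 hS.2
    refine ⟨⟨gam, T⟩, ?_, rfl⟩
    simp only [Finset.mem_sigma, Finset.mem_filter, Finset.mem_univ, true_and, mem_removals]
    exact ⟨⟨⟨hle, this.2.1⟩, this.2.2⟩, this.1⟩
  · rintro ⟨gam, T⟩ h
    simp only [Finset.mem_sigma, Finset.mem_filter, Finset.mem_univ, true_and, mem_removals] at h
    rw [Fin.prod_univ_castSucc, fiber_extend_last, mul_comm]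
    simp only [fiber_extend_castSucc h.1.1.1]

theorem tableauSum_cast (lam : YoungDiagram) {s t : ℕ} (h : s = t) (f : Fin t → ℕ) :
    tableauSum lam (fun k : Fin s => f (k.cast h)) = tableauSum lam f := by
  subst h
  rfl

theorem tableauSum_bot (f : Fin 0 → ℕ) : tableauSum ⊥ f = 1 := by
  classical
  have : IsEmpty {c : ℕ × ℕ // c ∈ (⊥ : YoungDiagram).cells} := ⟨fun c => Finset.notMem_empty c.1 c.2⟩
  rw [tableauSum, Finset.filter_true_of_mem fun S _ k => k.elim0]
  simp

/-! ### Induction over compositions -/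

/-- The sum of the signs of the rim-hook tableaux whose content is a list. -/
noncomputable def contentSum (lam : YoungDiagram) (l : List ℕ) : ℚ := tableauSum lam l.get

theorem contentSum_concat (lam : YoungDiagram) (l : List ℕ) (k : ℕ) :
    contentSum lam (l ++ [k]) = ∑ gam ∈ removals lam with (lam.cells \ gam.cells).card = k,
      sgn (lam.cells \ gam.cells) * contentSum gam l := by
  have h : l.length + 1 = (l ++ [k]).length := by simp
  rw [contentSum, ← tableauSum_cast lam h, tableauSum_succ]
  simp [contentSum]
  rfl

/-- The product of the partial sums of a list. -/
def partialSumProd (l : List ℕ) : ℕ := ∏ k ∈ Finset.range l.length, (l.take (k + 1)).sum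

theorem partialSumProd_concat (l : List ℕ) (k : ℕ) :
    partialSumProd (l ++ [k]) = partialSumProd l * (l.sum + k) := by
  rw [partialSumProd, List.length_append, List.length_singleton, Finset.prod_range_succ,
    partialSumProd]
  congr 1
  · refine Finset.prod_congr rfl fun i hi => ?_
    have := Finset.mem_range.1 hi
    rw [List.take_append_of_le_length (by omega)]
  · rw [List.take_of_length_le (by simp)]
    simp

/-- The composition of `n` with last block `n - m` that extends a composition of `m < n`. -/
def snoc {n : ℕ} (r : (m : Fin n) × Composition (m : ℕ)) : Composition n where
  blocks := r.2.blocks ++ [n - r.1]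
  blocks_pos := by
    intro i hi
    rw [List.mem_append, List.mem_singleton] at hi
    rcases hi with hi | rfl
    · exact r.2.blocks_pos hi
    · have := r.1.2
      omega
  blocks_sum := by
    have := r.1.2
    rw [List.sum_append, r.2.blocks_sum, List.sum_singleton]
    omega

/-- For `n > 0` a composition has a last block, and dropping it is the inverse. -/
theorem snoc_bijective {n : ℕ} (hn : 0 < n) : Function.Bijective (snoc (n := n)) := by
  constructor
  · rintro ⟨⟨m, hm⟩, c⟩ ⟨⟨m', hm'⟩, c'⟩ h
    have h1 := congrArg Composition.blocks h
    simp only [snoc] at h1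
    have h2 := (List.append_inj' h1 rfl).1
    have h3 := congrArg List.sum h2
    rw [c.blocks_sum, c'.blocks_sum] at h3
    dsimp only at h3
    subst h3
    rw [Composition.ext h2]
  · intro c
    have hne : c.blocks ≠ [] := by
      rw [Ne, Composition.blocks_eq_nil]
      exact hn.ne'
    have hsum := c.blocks_sum
    rw [← List.dropLast_append_getLast hne, List.sum_append, List.sum_singleton] at hsum
    have hpos := c.blocks_pos (List.getLast_mem hne)
    refine ⟨⟨⟨c.blocks.dropLast.sum, by omega⟩, ⟨c.blocks.dropLast,
      fun {i} hi => c.blocks_pos (List.mem_of_mem_dropLast hi), rfl⟩⟩, ?_⟩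
    apply Composition.ext
    simp only [snoc]
    conv_rhs => rw [← List.dropLast_append_getLast hne]
    congr 2
    omega

theorem sum_composition {n : ℕ} (hn : 0 < n) (F : List ℕ → ℚ) :
    ∑ c : Composition n, F c.blocks =
      ∑ m : Fin n, ∑ c : Composition (m : ℕ), F (c.blocks ++ [n - m]) := by
  rw [← Fintype.sum_sigma']
  exact (Fintype.sum_bijective snoc (snoc_bijective hn) _ _ fun r => rfl).symm

open Classical in
theorem contentSum_concat_sub {lam : YoungDiagram} {m : ℕ} (hm : m < lam.card) (l : List ℕ) :
    contentSum lam (l ++ [lam.card - m]) = ∑ gam ∈ removals lam with gam.card = (m : ℕ),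
      sgn (lam.cells \ gam.cells) * contentSum gam l := by
  rw [contentSum_concat]
  refine Finset.sum_congr (Finset.filter_congr fun gam h => ?_) fun _ _ => rfl
  have := card_sdiff_cells (mem_removals.1 h).1
  omega

open Classical in
-- This is part (2) with contents as lists. The induction runs over all diagrams of a given size,
-- because it is applied to the diagrams left after removing the last hooks from `lam` and `mu`.
theorem sum_contentSum_mul (n : ℕ) : ∀ lam mu : YoungDiagram, lam.card = n → mu.card = n →
    ∑ c : Composition n, contentSum lam c.blocks * contentSum mu c.blocks /
      (partialSumProd c.blocks : ℚ) = if lam = mu then 1 else 0 := by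
  induction n using Nat.strong_induction_on with
  | _ n ih =>
  intro lam mu hlam hmu
  rcases n.eq_zero_or_pos with rfl | hn
  · have hbot : ∀ nu : YoungDiagram, nu.card = 0 → nu = ⊥ := fun nu h =>
      YoungDiagram.ext (by rw [cells_bot]; exact Finset.card_eq_zero.1 h)
    obtain rfl := hbot _ hlam
    obtain rfl := hbot _ hmu
    have hnil : ∀ c : Composition 0, c.blocks = [] := fun c => c.blocks_eq_nil.2 rfl
    have h1 : contentSum ⊥ [] = 1 := tableauSum_bot _
    simp [hnil, h1, partialSumProd, composition_card]
  · have hn' : (n : ℚ) ≠ 0 := by exact_mod_cast hn.ne'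
    rw [sum_composition hn fun l => contentSum lam l * contentSum mu l / (partialSumProd l : ℚ)]
    have step : ∀ m : Fin n, ∑ c : Composition (m : ℕ), contentSum lam (c.blocks ++ [n - m]) *
        contentSum mu (c.blocks ++ [n - m]) / (partialSumProd (c.blocks ++ [n - m]) : ℚ) =
        ∑ gam ∈ removals lam ∩ removals mu with gam.card = (m : ℕ),
          sgn (lam.cells \ gam.cells) * sgn (mu.cells \ gam.cells) / n := by
      intro m
      have hm := m.2
      calc _ = ∑ c : Composition (m : ℕ), ∑ gam ∈ removals lam with gam.card = (m : ℕ),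
            ∑ del ∈ removals mu with del.card = (m : ℕ),
              sgn (lam.cells \ gam.cells) * sgn (mu.cells \ del.cells) / n *
                (contentSum gam c.blocks * contentSum del c.blocks /
                  (partialSumProd c.blocks : ℚ)) := by
            refine Finset.sum_congr rfl fun c _ => ?_
            have e1 := contentSum_concat_sub (lam := lam) (m := m) (by omega) c.blocks
            have e2 := contentSum_concat_sub (lam := mu) (m := m) (by omega) c.blocks
            rw [hlam] at e1
            rw [hmu] at e2
            -- The new last partial sum is `m + (n - m) = n`, the source of the factor `n⁻¹` in part
            -- (1).
            rw [e1, e2, Finset.sum_mul_sum, Finset.sum_div, partialSumProd_concat, c.blocks_sum,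
              Nat.add_sub_cancel' hm.le]
            refine Finset.sum_congr rfl fun gam _ => ?_
            rw [Finset.sum_div]
            refine Finset.sum_congr rfl fun del _ => ?_
            push_cast
            rw [div_mul_div_comm]
            congr 1 <;> ring
        _ = ∑ gam ∈ removals lam with gam.card = (m : ℕ), ∑ del ∈ removals mu with del.card = (m : ℕ),
              if gam = del then sgn (lam.cells \ gam.cells) * sgn (mu.cells \ del.cells) / n
              else 0 := by
            rw [Finset.sum_comm]
            refine Finset.sum_congr rfl fun gam hg => ?_
            rw [Finset.sum_comm]
            refine Finset.sum_congr rfl fun del hd => ?_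
            rw [← Finset.mul_sum, ih m hm gam del (Finset.mem_filter.1 hg).2
              (Finset.mem_filter.1 hd).2, mul_ite, mul_one, mul_zero]
        _ = _ := by
            simp only [Finset.sum_ite_eq]
            rw [← Finset.sum_filter]
            refine Finset.sum_congr ?_ fun _ _ => rfl
            ext gam
            simp only [Finset.mem_filter, Finset.mem_inter]
            tauto
    rw [Finset.sum_congr rfl fun m _ => step m]
    -- Summing over the sizes `m < n` reassembles the full sum over common removals.
    have hfib := Finset.sum_fiberwise_of_maps_to (s := removals lam ∩ removals mu)
      (t := Finset.range n) (g := YoungDiagram.card) (fun gam h => by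
        have := card_lt_of_mem_removals (Finset.mem_inter.1 h).1
        exact Finset.mem_range.2 (by omega))
      fun gam => sgn (lam.cells \ gam.cells) * sgn (mu.cells \ gam.cells) / (n : ℚ)
    rw [← Finset.sum_range fun m => ∑ gam ∈ removals lam ∩ removals mu with gam.card = (m : ℕ),
          sgn (lam.cells \ gam.cells) * sgn (mu.cells \ gam.cells) / (n : ℚ), hfib,
      ← Finset.sum_div, sum_removals (hlam.trans hmu.symm), hlam]
    split_ifs
    · exact div_self hn'
    · exact zero_div _

/-- The notions for diagrams copy those for partitions, and `blocksFun` is `blocks.get`, so both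
sides agree by definition. -/
theorem A_apply {n : ℕ} (lam : n.Partition) (be : Composition n) :
    A n lam be = contentSum lam.diagram be.blocks := rfl

theorem Z_eq {n : ℕ} (be : Composition n) : Z be = partialSumProd be.blocks :=
  Fin.prod_univ_eq_prod_range (fun k => be.sizeUpTo (k + 1)) be.length

end RimHook

theorem theorem3 :
    (∀ n : ℕ, 0 < n → ∀ lam mu : n.Partition,
      ∑ gam ∈ RimHook.G lam mu,
          (n : ℚ)⁻¹ * RimHook.sgn (RimHook.skew lam gam.2) * RimHook.sgn (RimHook.skew mu gam.2)
        = if lam = mu then 1 else 0) ∧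
    (∀ n : ℕ, RimHook.A n * RimHook.B n = 1) := by
  refine ⟨fun n hn lam mu => RimHook.sum_G_sgn hn lam mu, fun n => ?_⟩
  ext lam mu
  have h := RimHook.sum_contentSum_mul n lam.diagram mu.diagram lam.card_diagram mu.card_diagram
  simp only [(Nat.Partition.diagram_injective n).eq_iff] at h
  rw [Matrix.mul_apply, Matrix.one_apply, ← h]
  refine Finset.sum_congr rfl fun be _ => ?_
  simp only [RimHook.B, Matrix.of_apply, RimHook.A_apply, RimHook.Z_eq, mul_div_assoc]
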